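/- Let $p$ be a prime number, let $|\cdot|_p$ be the absolute value on $\mathbb{Q}_p$ with $|p|_p=p^{-1}$, and let $\gamma=(1+\sqrt5)/2$. For ${\bf x}=(x_0,x_1,x_2)\in\mathbb{Z}^3$ and $\xi_p\in\mathbb{Q}_p$ put $$\|{\bf x}\|_\infty=\max_{0\le l\le 2}|x_l|,\qquad L_p({\bf x})=\max_{0\le l\le 2}|x_l-x_0\xi_p^l|_p .$$ A real number $\lambda_p$ is called an exponent of approximation in degree $2$ to $\xi_p$ if there is a constant $c>0$ such that, for every real $X\ge1$, the inequalities $\|{\bf x}\|_\infty\le X$ and $L_p({\bf x})\le cX^{-\lambda_p}$ have a non-zero solution ${\bf x}\in\mathbb{Z}^3$. (i) For every $\epsilon>0$ there exist $\xi_p\in\mathbb{Q}_p$ with $[\mathbb{Q}(\xi_p):\mathbb{Q}]>2$ (possibly infinite) and a constant $c_1>0$ such that, for every real $X\ge1$, the inequalities $$\|{\bf x}\|_\infty\le X,\qquad \|{\bf x}\|_\infty\,L_p({\bf x})\le c_1X^{-1/\gamma+\epsilon}$$ have a non-zero solution ${\bf x}\in\mathbb{Z}^3$. (ii) Equivalently,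 for every real $\lambda_p<\gamma$ there exists $\xi_p\in\mathbb{Q}_p$ with $[\mathbb{Q}(\xi_p):\mathbb{Q}]>2$ such that $\lambda_p$ is an exponent of approximation in degree $2$ to $\xi_p$. (iii) The two properties are equivalent for each individual number: for every $\xi_p\in\mathbb{Q}_p$ and every $\epsilon\in\mathbb{R}$, there is a constant $c_1>0$ such that the inequalities in (i) have a non-zero solution in $\mathbb{Z}^3$ for every real $X\ge1$ if and only if $\gamma-\epsilon$ is an exponent of approximation in degree $2$ to $\xi_p$. -/

import Mathlib

namespace PadicApprox

/-- The quantity `L_p(x) = ‖x - x₀ t‖_p` with `t = (1, ξ, …, ξ ^ n)`, that is the maximum over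
`0 ≤ l ≤ n` of `|x_l - x₀ ξ ^ l|_p`, for an integer point `x = (x₀, …, x_n)`.
The norm on `Fin (n + 1) → ℚ_[p]` is the maximum norm. -/
noncomputable def L {p : ℕ} [Fact p.Prime] {n : ℕ} (ξ : ℚ_[p]) (x : Fin (n + 1) → ℤ) : ℝ :=
  ‖(fun l : Fin (n + 1) => (x l : ℚ_[p]) - (x 0 : ℚ_[p]) * ξ ^ (l : ℕ))‖

/-- `lam` is an exponent of approximation in degree `n` to `ξ`: for some `c > 0`, the
inequalities `‖x‖_∞ ≤ X` and `L_p(x) ≤ c X ^ (-lam)` have a non-zero solution `x ∈ ℤ ^ (n + 1)`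
for each real `X ≥ 1`. The norm of `x : Fin (n + 1) → ℤ` is `max |x_l|`. -/
def IsExponentOfApproximation {p : ℕ} [Fact p.Prime] (n : ℕ) (ξ : ℚ_[p]) (lam : ℝ) : Prop :=
  ∃ c : ℝ, 0 < c ∧ ∀ X : ℝ, 1 ≤ X →
    ∃ x : Fin (n + 1) → ℤ, x ≠ 0 ∧ ‖x‖ ≤ X ∧ L ξ x ≤ c * X ^ (-lam)

/-- `[ℚ(ξ) : ℚ] > 2`, the degree being a cardinal, so that transcendental `ξ` are included. -/
def DegreeGtTwo {p : ℕ} [Fact p.Prime] (ξ : ℚ_[p]) : Prop :=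
  2 < Module.rank ℚ (IntermediateField.adjoin ℚ ({ξ} : Set ℚ_[p]))

end PadicApprox

namespace PadicApprox

open Filter Topology

/-! ### Trading archimedean size against `p`-adic size. -/

section Exponents

variable {p : ℕ} [Fact p.Prime]

/-! Multiplying points by powers of `p` gives (iii), because `1 / γ = γ - 1`; hence (i) and (ii)
both reduce to constructing `ξ`. Take symmetric integer matrices `A`, `B` with the same determinant,
up to sign a power of `p`, and entries near its square root. Palindromic prefixes of the Fibonacci
word in `A`, `B` give symmetric products `M k` (`fibMatrix_isSymm`), each a left factor of the next,
so the ratios of their first-row entries converge `p`-adically to some `ξ`, with `L_p ≤ |det|_p` at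
the point of `M k` (`exists_forall_L_symmPoint_le`). With `ℓ = fibLength k`, this point has norm at
most `p ^ ((e + 5) * ℓ)` and `L_p` at most `p ^ (-(2 * e + 4) * ℓ)`. Lengths grow by a factor `γ`,
so the exponent `1 + (e - 1) / ((e + 5) * γ)` is reached, which tends to `1 + 1 / γ = γ` as `e → ∞`.
An integer quadratic relation for `ξ` would annihilate all late points, but infinitely many
consecutive triples are independent (`eq_zero_of_dotProduct_symmPoint`). -/

lemma L_nonneg {n : ℕ} (ξ : ℚ_[p]) (x : Fin (n + 1) → ℤ) : 0 ≤ L ξ x := norm_nonneg _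

lemma L_smul {n : ℕ} (ξ : ℚ_[p]) (m : ℤ) (x : Fin (n + 1) → ℤ) :
    L ξ (m • x) = ‖(m : ℚ_[p])‖ * L ξ x := by
  unfold L
  rw [← norm_smul]
  congr 1
  ext l
  simp only [Pi.smul_apply, smul_eq_mul, Int.cast_mul]
  ring

lemma one_le_norm_of_ne_zero {n : ℕ} {x : Fin n → ℤ} (hx : x ≠ 0) : 1 ≤ ‖x‖ := by
  obtain ⟨i, hi⟩ := Function.ne_iff.mp hx
  refine le_trans ?_ (norm_le_pi_norm x i)
  rw [Int.norm_eq_abs]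
  exact_mod_cast Int.one_le_abs hi

/-- Multiplying a point by a power of `p` trades its norm against `L_p` at no cost. -/
theorem isExponentOfApproximation_iff (n : ℕ) (ξ : ℚ_[p]) (lam : ℝ) :
    IsExponentOfApproximation n ξ lam ↔
      ∃ c : ℝ, 0 < c ∧ ∀ X : ℝ, 1 ≤ X → ∃ x : Fin (n + 1) → ℤ, x ≠ 0 ∧
        ‖x‖ ≤ X ∧ ‖x‖ * L ξ x ≤ c * X ^ (1 - lam) := by
  have hp1 : (1 : ℝ) < p := by exact_mod_cast (Fact.out : p.Prime).one_lt
  constructor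
  · rintro ⟨c, hc, h⟩
    refine ⟨c, hc, fun X hX => ?_⟩
    obtain ⟨x, hx0, hxX, hx⟩ := h X hX
    refine ⟨x, hx0, hxX, ?_⟩
    have hX0 : 0 < X := by linarith
    calc ‖x‖ * L ξ x ≤ X * (c * X ^ (-lam)) :=
          mul_le_mul hxX hx (L_nonneg _ _) hX0.le
      _ = c * X ^ (1 - lam) := by
          rw [sub_eq_add_neg, Real.rpow_add hX0, Real.rpow_one]; ring
  · rintro ⟨c, hc, h⟩
    refine ⟨p * c, by positivity, fun X hX => ?_⟩
    obtain ⟨x, hx0, hxX, hx⟩ := h X hX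
    have hX0 : 0 < X := by linarith
    have hx1 := one_le_norm_of_ne_zero hx0
    have hx1' : 0 < ‖x‖ := by linarith
    -- The largest `k` with `p ^ k * ‖x‖ ≤ X`; overshooting by at most one factor `p` explains the
    -- constant `p * c`.
    obtain ⟨k, hk1, hk2⟩ := exists_nat_pow_near ((one_le_div hx1').mpr hxX) hp1
    rw [le_div_iff₀ hx1'] at hk1
    rw [div_lt_iff₀ hx1'] at hk2
    have hpk : (0 : ℝ) < (p : ℝ) ^ k := by positivity
    refine ⟨((p : ℤ) ^ k) • x, ?_, ?_, ?_⟩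
    · exact smul_ne_zero (pow_ne_zero _ (by exact_mod_cast (Fact.out : p.Prime).ne_zero)) hx0
    · rw [norm_smul, norm_pow, Int.norm_natCast]
      exact hk1
    · rw [L_smul]
      have e : ‖(((p : ℤ) ^ k : ℤ) : ℚ_[p])‖ = ((p : ℝ) ^ k)⁻¹ := by
        push_cast
        rw [norm_pow, Padic.norm_p, inv_pow]
      rw [e, inv_mul_le_iff₀ hpk]
      have e2 : X ^ (1 - lam) = X * X ^ (-lam) := by
        rw [sub_eq_add_neg, Real.rpow_add hX0, Real.rpow_one]
      rw [e2] at hx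
      have hY : 0 < X ^ (-lam) := Real.rpow_pos_of_pos hX0 _
      refine le_of_mul_le_mul_left ?_ hx1'
      calc ‖x‖ * L ξ x ≤ c * (X * X ^ (-lam)) := hx
        _ ≤ c * (((p : ℝ) ^ (k + 1) * ‖x‖) * X ^ (-lam)) := by gcongr
        _ = _ := by ring

lemma IsExponentOfApproximation.mono {n : ℕ} {ξ : ℚ_[p]} {lam mu : ℝ}
    (h : IsExponentOfApproximation n ξ mu) (hle : lam ≤ mu) :
    IsExponentOfApproximation n ξ lam := by
  obtain ⟨c, hc, h⟩ := h
  refine ⟨c, hc, fun X hX => ?_⟩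
  obtain ⟨x, hx0, hxX, hx⟩ := h X hX
  refine ⟨x, hx0, hxX, hx.trans ?_⟩
  gcongr

end Exponents

/-! ### Criteria for degree greater than two and for the vanishing of an integer. -/

section Degree

variable {p : ℕ} [Fact p.Prime]

lemma degreeGtTwo_of_forall_int {ξ : ℚ_[p]}
    (h : ∀ c : Fin 3 → ℤ, (c 0 : ℚ_[p]) + c 1 * ξ + c 2 * ξ ^ 2 = 0 → c = 0) :
    DegreeGtTwo ξ := by
  let K := IntermediateField.adjoin ℚ ({ξ} : Set ℚ_[p])
  let a : K := ⟨ξ, IntermediateField.mem_adjoin_simple_self ℚ ξ⟩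
  have hli : LinearIndependent ℤ (fun i : Fin 3 => a ^ (i : ℕ)) := by
    rw [Fintype.linearIndependent_iff]
    intro g hg
    have : g = 0 := by
      apply h
      have := congrArg (fun z : K => (z : ℚ_[p])) hg
      simpa [Fin.sum_univ_three, a] using this
    simp [this]
  have hli' : LinearIndependent ℚ (fun i : Fin 3 => a ^ (i : ℕ)) :=
    (LinearIndependent.iff_fractionRing ℤ ℚ).mp hli
  have := hli'.cardinal_le_rank
  refine lt_of_lt_of_le ?_ this
  simp only [Cardinal.mk_fin]
  exact_mod_cast (by norm_num : 2 < 3)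

lemma int_eq_zero_of_norm_padic_le {N : ℕ} {z : ℤ} (h1 : ‖(z : ℚ_[p])‖ ≤ ((p : ℝ) ^ N)⁻¹)
    (h2 : ‖z‖ < (p : ℝ) ^ N) : z = 0 := by
  rw [← zpow_natCast, ← zpow_neg, Padic.norm_int_le_pow_iff_dvd] at h1
  refine Int.eq_zero_of_abs_lt_dvd h1 ?_
  rw [Int.norm_eq_abs] at h2
  exact_mod_cast h2

end Degree

/-! ### Fibonacci products of symmetric matrices. -/

section Matrices

open Matrix

/-- The sequence `1, A, ABA, ABAABA, …` of the matrices of the palindromic prefixes of the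
infinite Fibonacci word in `A` and `B`. -/
def fibMatrix (A B : Matrix (Fin 2) (Fin 2) ℤ) : ℕ → Matrix (Fin 2) (Fin 2) ℤ
  | 0 => 1
  | 1 => A
  | k + 2 => fibMatrix A B (k + 1) * (if Even k then B * A else A * B) * fibMatrix A B k

/-- The number of letters of the word that defines `fibMatrix A B k`. -/
def fibLength : ℕ → ℕ
  | 0 => 0
  | 1 => 1
  | k + 2 => fibLength (k + 1) + 2 + fibLength k

lemma fibLength_add_two (k : ℕ) : fibLength k + 2 = Nat.fib (k + 3) := by
  induction k using Nat.twoStepInduction with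
  | zero => rfl
  | one => rfl
  | more k h1 h2 =>
    have : Nat.fib (k + 2 + 3) = Nat.fib (k + 3) + Nat.fib (k + 1 + 3) := Nat.fib_add_two
    rw [fibLength]
    omega

lemma fibLength_lt_succ (k : ℕ) : fibLength k < fibLength (k + 1) := by
  cases k with
  | zero => decide
  | succ k => rw [fibLength]; omega

lemma le_fibLength (k : ℕ) : k ≤ fibLength k :=
  (strictMono_nat_of_lt_succ fibLength_lt_succ).le_apply

/-- Since `fib (n + 1) - γ * fib n` is a power of the conjugate of `γ`, hence at most 1, the error
is at most `2 * γ - 1 < 3`. -/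
lemma fibLength_succ_le (k : ℕ) :
    (fibLength (k + 1) : ℝ) ≤ Real.goldenRatio * fibLength k + 3 := by
  have h1 : (fibLength k : ℝ) + 2 = Nat.fib (k + 3) := by exact_mod_cast fibLength_add_two k
  have h2 : (fibLength (k + 1) : ℝ) + 2 = Nat.fib (k + 3 + 1) := by
    exact_mod_cast fibLength_add_two (k + 1)
  have h3 := Real.fib_succ_sub_goldenRatio_mul_fib (k + 3)
  have h4 : Real.goldenConj ^ (k + 3) ≤ 1 := by
    refine (le_abs_self _).trans ?_
    rw [abs_pow]
    refine pow_le_one₀ (abs_nonneg _) (abs_le.mpr ⟨Real.neg_one_lt_goldenConj.le, ?_⟩)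
    linarith [Real.goldenConj_neg]
  have h5 := Real.goldenRatio_lt_two
  rw [← h1, ← h2] at h3
  linarith

variable {A B : Matrix (Fin 2) (Fin 2) ℤ}

lemma fibMatrix_isSymm (hA : A.IsSymm) (hB : B.IsSymm) (k : ℕ) : (fibMatrix A B k).IsSymm := by
  suffices h : (fibMatrix A B k).IsSymm ∧ (fibMatrix A B (k + 1)).IsSymm ∧
      (fibMatrix A B (k + 2)).IsSymm from h.1
  induction k with
  | zero =>
    refine ⟨?_, hA, ?_⟩
    · simp [fibMatrix]
    · simp [fibMatrix, Matrix.IsSymm, transpose_mul, hA.eq, hB.eq, Matrix.mul_assoc]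
  | succ k ih =>
    obtain ⟨h1, h2, h3⟩ := ih
    refine ⟨h2, h3, ?_⟩
    -- Unfolding twice exhibits a palindrome: the two middle factors are `A * B` and `B * A` in some
    -- order, transposes of each other.
    have e : fibMatrix A B (k + 1 + 2) =
      fibMatrix A B (k + 1) * (if Even k then B * A else A * B) * fibMatrix A B k *
        (if Even (k + 1) then B * A else A * B) * fibMatrix A B (k + 1) := rfl
    rw [Matrix.IsSymm, e]
    by_cases hk : Even k
    · simp [hk, Nat.even_add_one, transpose_mul, hA.eq, hB.eq, h1.eq, h2.eq, Matrix.mul_assoc]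
    · simp [hk, Nat.even_add_one, transpose_mul, hA.eq, hB.eq, h1.eq, h2.eq, Matrix.mul_assoc]

lemma det_fibMatrix {d : ℤ} (hA : A.det = d) (hB : B.det = d) (k : ℕ) :
    (fibMatrix A B k).det = d ^ fibLength k := by
  induction k using Nat.twoStepInduction with
  | zero => simp [fibMatrix, fibLength]
  | one => simp [fibMatrix, fibLength, hA]
  | more k h1 h2 =>
    rw [fibMatrix, fibLength, det_mul, det_mul, h1, h2]
    split_ifs <;> rw [det_mul, hA, hB] <;> ring

lemma abs_mul_apply_le {M N : Matrix (Fin 2) (Fin 2) ℤ} {a b : ℤ} (hM : ∀ i j, |M i j| ≤ a)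
    (hN : ∀ i j, |N i j| ≤ b) (i j : Fin 2) : |(M * N) i j| ≤ 2 * (a * b) := by
  rw [mul_apply, Fin.sum_univ_two]
  have ha : 0 ≤ a := (abs_nonneg _).trans (hM 0 0)
  have h : ∀ l, |M i l * N l j| ≤ a * b := fun l => by
    rw [abs_mul]
    exact mul_le_mul (hM i l) (hN l j) (abs_nonneg _) ha
  refine (abs_add_le _ _).trans ?_
  linarith [h 0, h 1]

/-- Each product of 2×2 matrices costs a factor 2, so a recursion step costs `8 * a ^ 2 ≤ b ^ 2`,
paid for by the two extra letters. -/
lemma abs_fibMatrix_apply_le {a b : ℤ} (hA : ∀ i j, |A i j| ≤ a) (hB : ∀ i j, |B i j| ≤ a)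
    (hab : 3 * a ≤ b) (k : ℕ) : ∀ i j, |fibMatrix A B k i j| ≤ b ^ fibLength k := by
  have ha : 0 ≤ a := (abs_nonneg _).trans (hA 0 0)
  induction k using Nat.twoStepInduction with
  | zero => intro i j; fin_cases i <;> fin_cases j <;> simp [fibMatrix, fibLength]
  | one => intro i j; simpa [fibMatrix, fibLength] using (hA i j).trans (by linarith)
  | more k h1 h2 =>
    intro i j
    have hS : ∀ i j, |(if Even k then B * A else A * B) i j| ≤ 2 * (a * a) := by
      split_ifs
      · exact abs_mul_apply_le hB hA
      · exact abs_mul_apply_le hA hB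
    refine (abs_mul_apply_le (abs_mul_apply_le h2 hS) h1 i j).trans ?_
    have hb : 0 ≤ b := by linarith
    have h8 : 8 * (a * a) ≤ b ^ 2 := by nlinarith
    rw [fibLength]
    calc 2 * (2 * (b ^ fibLength (k + 1) * (2 * (a * a))) * b ^ fibLength k)
        = b ^ fibLength (k + 1) * (8 * (a * a)) * b ^ fibLength k := by ring
      _ ≤ b ^ fibLength (k + 1) * b ^ 2 * b ^ fibLength k := by gcongr
      _ = _ := by ring

/-- First row `(1, 0)` modulo `m` is stable under products. With `m = p` this makes the upper left
entries `p`-adic units. -/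
lemma fibMatrix_zero_modEq {m : ℤ} (hA : A 0 0 ≡ 1 [ZMOD m] ∧ A 0 1 ≡ 0 [ZMOD m])
    (hB : B 0 0 ≡ 1 [ZMOD m] ∧ B 0 1 ≡ 0 [ZMOD m]) (k : ℕ) :
    fibMatrix A B k 0 0 ≡ 1 [ZMOD m] ∧ fibMatrix A B k 0 1 ≡ 0 [ZMOD m] := by
  have key : ∀ M N : Matrix (Fin 2) (Fin 2) ℤ, (M 0 0 ≡ 1 [ZMOD m] ∧ M 0 1 ≡ 0 [ZMOD m]) →
      (N 0 0 ≡ 1 [ZMOD m] ∧ N 0 1 ≡ 0 [ZMOD m]) →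
      ((M * N) 0 0 ≡ 1 [ZMOD m] ∧ (M * N) 0 1 ≡ 0 [ZMOD m]) := by
    rintro M N ⟨h1, h2⟩ ⟨h3, h4⟩
    simp only [mul_apply, Fin.sum_univ_two]
    exact ⟨by simpa using (h1.mul h3).add (h2.mul_right (N 1 0)),
      by simpa using (h1.mul h4).add (h2.mul_right (N 1 1))⟩
  induction k using Nat.twoStepInduction with
  | zero => exact ⟨by simp [fibMatrix], by simp [fibMatrix]⟩
  | one => exact hA
  | more k h1 h2 =>
    refine key _ _ (key _ _ h2 ?_) h1
    split_ifs
    · exact key _ _ hB hA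
    · exact key _ _ hA hB

/-- The point of `ℤ³` formed by the entries of a symmetric matrix. -/
def symmPoint (M : Matrix (Fin 2) (Fin 2) ℤ) : Fin 3 → ℤ := ![M 0 0, M 0 1, M 1 1]

/-- Three symmetric matrices `M`, `N`, `N S M` with `S` not symmetric and `det M`, `det N` not
zero are linearly independent. -/
lemma eq_zero_of_dotProduct_symmPoint {M N S : Matrix (Fin 2) (Fin 2) ℤ} (hM : M.IsSymm)
    (hN : N.IsSymm) (hNM : (N * S * M).IsSymm) (hM0 : M.det ≠ 0) (hN0 : N.det ≠ 0)
    (hS : S 0 1 ≠ S 1 0) {c : Fin 3 → ℤ} (h1 : c ⬝ᵥ symmPoint M = 0)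
    (h2 : c ⬝ᵥ symmPoint N = 0) (h3 : c ⬝ᵥ symmPoint (N * S * M) = 0) : c = 0 := by
  let Q : Matrix (Fin 3) (Fin 3) ℤ := of ![symmPoint M, symmPoint N, symmPoint (N * S * M)]
  have hM1 := hM.apply 0 1
  have hN1 := hN.apply 0 1
  have hs := hNM.apply 0 1
  have hQ : Q.det = M.det * N.det * (S 1 0 - S 0 1) := by
    simp only [Q, det_fin_three, det_fin_two, symmPoint, of_apply, mul_apply, Fin.sum_univ_two,
      cons_val_zero, cons_val_one, cons_val] at hs ⊢
    rw [hM1, hN1] at hs ⊢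
    -- The determinant formula is not a formal identity in the entries; it uses the symmetry `hs` of
    -- the product.
    linear_combination (M 0 1 * N 0 1 - M 1 1 * N 0 0) * hs
  have hQ0 : Q.det ≠ 0 := by
    rw [hQ]
    exact mul_ne_zero (mul_ne_zero hM0 hN0) (sub_ne_zero.mpr hS.symm)
  refine Matrix.eq_zero_of_mulVec_eq_zero hQ0 ?_
  ext i
  fin_cases i
  · simpa [Q, mulVec, dotProduct_comm] using h1
  · simpa [Q, mulVec, dotProduct_comm] using h2
  · simpa [Q, mulVec, dotProduct_comm] using h3

end Matrices

/-! ### The `p`-adic limit and its approximations. -/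

section Limit

variable {p : ℕ} [Fact p.Prime]

lemma norm_div_sub_div_le {M Y : Matrix (Fin 2) (Fin 2) ℤ} (hM : M.IsSymm)
    (h0 : ‖(M 0 0 : ℚ_[p])‖ = 1) (h1 : ‖((M * Y) 0 0 : ℚ_[p])‖ = 1) (hMY : (M * Y).IsSymm) :
    ‖((M * Y) 0 1 : ℚ_[p]) / (M * Y) 0 0 - M 0 1 / M 0 0‖ ≤ ‖(M.det : ℚ_[p])‖ := by
  have h0' : (M 0 0 : ℚ_[p]) ≠ 0 := by rw [← norm_ne_zero_iff, h0]; exact one_ne_zero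
  have h1' : ((M * Y) 0 0 : ℚ_[p]) ≠ 0 := by rw [← norm_ne_zero_iff, h1]; exact one_ne_zero
  -- Cramer's rule for the first column of `M * Y`, after using symmetry to replace the `0 1`
  -- entries by the `1 0` entries.
  have e : (M * Y) 0 1 * M 0 0 - (M * Y) 0 0 * M 0 1 = M.det * Y 1 0 := by
    rw [← hMY.apply 0 1]
    simp only [Matrix.mul_apply, Fin.sum_univ_two, Matrix.det_fin_two]
    rw [hM.apply 0 1]
    ring
  have e' : ((M * Y) 0 1 : ℚ_[p]) / (M * Y) 0 0 - M 0 1 / M 0 0 =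
      M.det * Y 1 0 / ((M * Y) 0 0 * M 0 0) := by
    rw [div_sub_div _ _ h1' h0']
    congr 1
    exact_mod_cast e
  rw [e', norm_div, norm_mul, norm_mul, h0, h1, mul_one, div_one]
  exact mul_le_of_le_one_right (norm_nonneg _) (Padic.norm_int_le_one _)

lemma L_symmPoint_le {M : Matrix (Fin 2) (Fin 2) ℤ} (hM : M.IsSymm)
    (h0 : ‖(M 0 0 : ℚ_[p])‖ = 1) {ξ : ℚ_[p]} (hξ1 : ‖ξ‖ ≤ 1)
    (hξ : ‖ξ - M 0 1 / M 0 0‖ ≤ ‖(M.det : ℚ_[p])‖) :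
    L ξ (n := 2) (symmPoint M) ≤ ‖(M.det : ℚ_[p])‖ := by
  have h0' : (M 0 0 : ℚ_[p]) ≠ 0 := by rw [← norm_ne_zero_iff, h0]; exact one_ne_zero
  have e1 : (M 0 1 : ℚ_[p]) - M 0 0 * ξ = -(M 0 0 * (ξ - M 0 1 / M 0 0)) := by
    field_simp
    ring
  have n1 : ‖(M 0 1 : ℚ_[p]) - M 0 0 * ξ‖ ≤ ‖(M.det : ℚ_[p])‖ := by
    rw [e1, norm_neg, norm_mul, h0, one_mul]
    exact hξ
  have e2 : (M 1 1 : ℚ_[p]) - M 0 0 * ξ ^ 2 =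
      M.det / M 0 0 + (M 0 1 - M 0 0 * ξ) * (M 0 1 / M 0 0 + ξ) := by
    have hs : (M 1 0 : ℚ_[p]) = M 0 1 := by exact_mod_cast hM.apply 0 1
    rw [Matrix.det_fin_two]
    push_cast
    rw [hs]
    field_simp
    ring
  refine (pi_norm_le_iff_of_nonneg (norm_nonneg _)).mpr fun l => ?_
  fin_cases l
  · simp [symmPoint]
  · simpa [symmPoint] using n1
  · have n2 : ‖(M 0 1 / M 0 0 : ℚ_[p]) + ξ‖ ≤ 1 := by
      refine (Padic.nonarchimedean _ _).trans (max_le ?_ hξ1)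
      rw [norm_div, h0, div_one]
      exact Padic.norm_int_le_one _
    have n3 : ‖(M 1 1 : ℚ_[p]) - M 0 0 * ξ ^ 2‖ ≤ ‖(M.det : ℚ_[p])‖ := by
      rw [e2]
      refine (Padic.nonarchimedean _ _).trans (max_le ?_ ?_)
      · rw [norm_div, h0, div_one]
      · rw [norm_mul]
        exact (mul_le_mul n1 n2 (norm_nonneg _) (norm_nonneg _)).trans (mul_one _).le
    simpa [symmPoint] using n3

/-- If each matrix of a sequence of symmetric matrices divides the later ones on the left, then
the corresponding points converge to a point `(1, ξ, ξ ^ 2)`. -/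
theorem exists_forall_L_symmPoint_le {M : ℕ → Matrix (Fin 2) (Fin 2) ℤ}
    (hM : ∀ k, (M k).IsSymm) (h0 : ∀ k, ‖(M k 0 0 : ℚ_[p])‖ = 1)
    (hdvd : ∀ k m, k ≤ m → ∃ Y, M m = M k * Y)
    (hdet : Tendsto (fun k => ‖((M k).det : ℚ_[p])‖) atTop (𝓝 0)) :
    ∃ ξ : ℚ_[p], ∀ k, L ξ (n := 2) (symmPoint (M k)) ≤ ‖((M k).det : ℚ_[p])‖ := by
  let u : ℕ → ℚ_[p] := fun k => M k 0 1 / M k 0 0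
  have hu : ∀ k m, k ≤ m → ‖u m - u k‖ ≤ ‖((M k).det : ℚ_[p])‖ := by
    intro k m hkm
    obtain ⟨Y, hY⟩ := hdvd k m hkm
    simp only [u, hY]
    exact norm_div_sub_div_le (hM k) (h0 k) (hY ▸ h0 m) (hY ▸ hM m)
  have hcau : CauchySeq u := by
    refine cauchySeq_of_le_tendsto_0 _ (fun n m N hn hm => ?_) hdet
    rw [dist_eq_norm, ← sub_sub_sub_cancel_right (u n) (u m) (u N), sub_eq_add_neg]
    refine (Padic.nonarchimedean _ _).trans (max_le (hu N n hn) ?_)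
    rw [norm_neg]
    exact hu N m hm
  obtain ⟨ξ, hξ⟩ := cauchySeq_tendsto_of_complete hcau
  refine ⟨ξ, fun k => L_symmPoint_le (hM k) (h0 k) ?_ ?_⟩
  · refine le_of_tendsto' hξ.norm fun m => ?_
    rw [norm_div, h0, div_one]
    exact Padic.norm_int_le_one _
  · refine le_of_tendsto (hξ.sub_const (u k)).norm ?_
    filter_upwards [eventually_ge_atTop k] with m hm using hu k m hm

/-- Subtracting `x 0` times the relation turns the integer `c ⬝ᵥ x` into an integer combination of
the differences measured by `L`. -/
lemma norm_dotProduct_le_L {n : ℕ} {ξ : ℚ_[p]} {c : Fin (n + 1) → ℤ}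
    (hc : ∑ l, (c l : ℚ_[p]) * ξ ^ (l : ℕ) = 0) (x : Fin (n + 1) → ℤ) :
    ‖((c ⬝ᵥ x : ℤ) : ℚ_[p])‖ ≤ L ξ x := by
  have e : ((c ⬝ᵥ x : ℤ) : ℚ_[p]) = ∑ l, (c l : ℚ_[p]) * (x l - x 0 * ξ ^ (l : ℕ)) := by
    have : ∑ l, (c l : ℚ_[p]) * (x l - x 0 * ξ ^ (l : ℕ)) =
        ∑ l, (c l : ℚ_[p]) * x l - x 0 * ∑ l, (c l : ℚ_[p]) * ξ ^ (l : ℕ) := by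
      rw [Finset.mul_sum, ← Finset.sum_sub_distrib]
      exact Finset.sum_congr rfl fun l _ => by ring
    rw [this, hc, mul_zero, sub_zero]
    simp [dotProduct]
  rw [e]
  refine IsUltrametricDist.norm_sum_le_of_forall_le_of_nonneg (L_nonneg _ _) fun l _ => ?_
  rw [norm_mul]
  refine (mul_le_of_le_one_left (norm_nonneg _) (Padic.norm_int_le_one _)).trans ?_
  exact norm_le_pi_norm (fun l : Fin (n + 1) => (x l : ℚ_[p]) - (x 0 : ℚ_[p]) * ξ ^ (l : ℕ)) l

end Limit

/-! ### Choice of the matrices, construction of `ξ`, and the exponent. -/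

section Construction

open Matrix

lemma fibMatrix_eq_mul (A B : Matrix (Fin 2) (Fin 2) ℤ) {k m : ℕ} (hkm : k ≤ m) :
    ∃ Y, fibMatrix A B m = fibMatrix A B k * Y := by
  induction m, hkm using Nat.le_induction with
  | base => exact ⟨1, (mul_one _).symm⟩
  | succ m _ ih =>
    obtain ⟨Y, hY⟩ := ih
    cases m with
    | zero => exact ⟨Y * A, by rw [← Matrix.mul_assoc, ← hY]; simp [fibMatrix]⟩
    | succ m =>
      refine ⟨Y * ((if Even m then B * A else A * B) * fibMatrix A B m), ?_⟩
      rw [fibMatrix, hY, ← Matrix.mul_assoc, ← Matrix.mul_assoc]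

lemma norm_symmPoint_le {M : Matrix (Fin 2) (Fin 2) ℤ} {b : ℤ} (h : ∀ i j, |M i j| ≤ b) :
    ‖symmPoint M‖ ≤ b := by
  have hb : (0 : ℝ) ≤ b := by exact_mod_cast (abs_nonneg _).trans (h 0 0)
  refine (pi_norm_le_iff_of_nonneg hb).mpr fun l => ?_
  rw [Int.norm_eq_abs]
  fin_cases l
  · exact_mod_cast h 0 0
  · exact_mod_cast h 0 1
  · exact_mod_cast h 1 1

/-- A symmetric matrix of determinant `-q ^ (2 * e + 4)` whose entries are at most `q ^ (e + 3)`
in absolute value. -/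
def baseMatrix (q : ℤ) (e : ℕ) : Matrix (Fin 2) (Fin 2) ℤ :=
  !![1 + q ^ (e + 1), q; q, q ^ 2 * (1 - q ^ (e + 1))]

/-- The conjugate of `baseMatrix q e` by the diagonal matrix `(1, -1)`. -/
def baseMatrixConj (q : ℤ) (e : ℕ) : Matrix (Fin 2) (Fin 2) ℤ :=
  !![1 + q ^ (e + 1), -q; -q, q ^ 2 * (1 - q ^ (e + 1))]

lemma baseMatrix_isSymm (q : ℤ) (e : ℕ) : (baseMatrix q e).IsSymm := by
  ext i j; fin_cases i <;> fin_cases j <;> rfl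

lemma baseMatrixConj_isSymm (q : ℤ) (e : ℕ) : (baseMatrixConj q e).IsSymm := by
  ext i j; fin_cases i <;> fin_cases j <;> rfl

lemma det_baseMatrix (q : ℤ) (e : ℕ) : (baseMatrix q e).det = -q ^ (2 * e + 4) := by
  rw [baseMatrix, det_fin_two_of]; ring

lemma det_baseMatrixConj (q : ℤ) (e : ℕ) : (baseMatrixConj q e).det = -q ^ (2 * e + 4) := by
  rw [baseMatrixConj, det_fin_two_of]; ring

lemma abs_baseMatrix_apply_le {q : ℤ} (hq : 2 ≤ q) (e : ℕ) (i j : Fin 2) :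
    |baseMatrix q e i j| ≤ q ^ (e + 3) ∧ |baseMatrixConj q e i j| ≤ q ^ (e + 3) := by
  have h1 : 1 ≤ q ^ e := one_le_pow₀ (by linarith)
  have h2 : q ^ (e + 1) = q ^ e * q := pow_succ _ _
  have h3 : q ^ (e + 3) = q ^ e * q * q ^ 2 := by ring
  have h4 : q ≤ q ^ e * q := le_mul_of_one_le_left (by linarith) h1
  have h5 : q ^ e * q * 4 ≤ q ^ e * q * q ^ 2 := by
    gcongr
    nlinarith
  have h6 : 0 < q ^ 2 := by positivity
  have h7 : |1 + q ^ (e + 1)| ≤ q ^ (e + 3) := by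
    rw [abs_le, h2, h3]; constructor <;> linarith
  have h8 : |q| ≤ q ^ (e + 3) := by
    rw [abs_le, h3]; constructor <;> linarith
  have h9 : |q ^ 2 * (1 - q ^ (e + 1))| ≤ q ^ (e + 3) := by
    rw [abs_le, h2, h3]; constructor <;> nlinarith
  fin_cases i <;> fin_cases j <;> simp only [baseMatrix, baseMatrixConj] <;>
    simp [h7, h8, h9, -abs_mul, -abs_pow]

lemma baseMatrix_zero_modEq (q : ℤ) (e : ℕ) :
    baseMatrix q e 0 0 ≡ 1 [ZMOD q] ∧ baseMatrix q e 0 1 ≡ 0 [ZMOD q] := by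
  constructor <;> simp [baseMatrix, Int.modEq_iff_dvd, pow_succ]

lemma baseMatrixConj_zero_modEq (q : ℤ) (e : ℕ) :
    baseMatrixConj q e 0 0 ≡ 1 [ZMOD q] ∧ baseMatrixConj q e 0 1 ≡ 0 [ZMOD q] := by
  constructor <;> simp [baseMatrixConj, Int.modEq_iff_dvd, pow_succ]

/-- The two entries are opposite, and nonzero because `q ^ (e + 3) ≥ q ^ 2`. -/
lemma baseMatrixConj_mul_apply_ne {q : ℤ} (hq : 2 ≤ q) (e : ℕ) :
    (baseMatrixConj q e * baseMatrix q e) 0 1 ≠ (baseMatrixConj q e * baseMatrix q e) 1 0 := by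
  have h1 : q ^ 2 ≤ q ^ (e + 3) := pow_le_pow_right₀ (by linarith) (by omega)
  have h2 : 0 < q ^ (e + 1) := by positivity
  have h3 : q * (1 + q ^ (e + 1) - q ^ 2 + q ^ (e + 3)) ≠ 0 :=
    mul_ne_zero (by linarith) (by linarith)
  intro h
  apply h3
  simp only [baseMatrix, baseMatrixConj, mul_apply, Fin.sum_univ_two, of_apply, cons_val_zero,
    cons_val_one, cons_val', cons_val_fin_one] at h
  have e1 : q ^ (e + 3) = q ^ (e + 1) * q ^ 2 := by ring
  rw [e1]
  linarith

theorem exists_degreeGtTwo_forall_exists_L_le (p : ℕ) [Fact p.Prime] {e : ℕ} (he : 2 ≤ e) :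
    ∃ ξ : ℚ_[p], DegreeGtTwo ξ ∧ ∀ k, ∃ x : Fin 3 → ℤ, x ≠ 0 ∧
      ‖x‖ ≤ (p : ℝ) ^ ((e + 5) * fibLength k) ∧
      L ξ (n := 2) x ≤ ((p : ℝ) ^ ((2 * e + 4) * fibLength k))⁻¹ := by
  have hp : p.Prime := Fact.out
  have hp2 : (2 : ℤ) ≤ p := by exact_mod_cast hp.two_le
  have hp1 : (1 : ℝ) < p := by exact_mod_cast hp.one_lt
  let A := baseMatrix p e
  let B := baseMatrixConj p e
  let M := fibMatrix A B
  have hsymm : ∀ k, (M k).IsSymm :=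
    fibMatrix_isSymm (baseMatrix_isSymm _ _) (baseMatrixConj_isSymm _ _)
  have hunit : ∀ k, ‖(M k 0 0 : ℚ_[p])‖ = 1 := by
    intro k
    rw [Padic.norm_intCast_eq_one_iff]
    have h := (fibMatrix_zero_modEq (baseMatrix_zero_modEq (p : ℤ) e)
      (baseMatrixConj_zero_modEq (p : ℤ) e) k).1
    obtain ⟨t, ht⟩ := Int.modEq_iff_dvd.mp h
    exact ⟨1, t, by linear_combination -ht⟩
  have hdet : ∀ k, (M k).det = (-(p : ℤ) ^ (2 * e + 4)) ^ fibLength k :=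
    det_fibMatrix (det_baseMatrix _ _) (det_baseMatrixConj _ _)
  have hdet0 : ∀ k, (M k).det ≠ 0 := fun k => by
    rw [hdet]
    exact pow_ne_zero _ (neg_ne_zero.mpr (pow_ne_zero _ (by linarith)))
  have hdetp : ∀ k, ‖((M k).det : ℚ_[p])‖ = ((p : ℝ) ^ ((2 * e + 4) * fibLength k))⁻¹ := by
    intro k
    rw [hdet]
    push_cast
    rw [norm_pow, norm_neg, norm_pow, Padic.norm_p, ← pow_mul, inv_pow]
  have habs : ∀ k i j, |M k i j| ≤ ((p : ℤ) ^ (e + 5)) ^ fibLength k := by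
    refine abs_fibMatrix_apply_le (fun i j => (abs_baseMatrix_apply_le hp2 e i j).1)
      (fun i j => (abs_baseMatrix_apply_le hp2 e i j).2) ?_
    have : (p : ℤ) ^ (e + 5) = p ^ 2 * p ^ (e + 3) := by ring
    rw [this]
    gcongr
    nlinarith
  have hnorm : ∀ k, ‖symmPoint (M k)‖ ≤ (p : ℝ) ^ ((e + 5) * fibLength k) := by
    intro k
    have := norm_symmPoint_le (habs k)
    push_cast at this
    rwa [← pow_mul] at this
  obtain ⟨ξ, hξ⟩ := exists_forall_L_symmPoint_le hsymm hunit
    (fun k m hkm => fibMatrix_eq_mul A B hkm) (by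
      simp only [hdetp]
      refine tendsto_inv_atTop_zero.comp ((tendsto_pow_atTop_atTop_of_one_lt hp1).comp ?_)
      refine tendsto_atTop_mono (fun k => ?_) tendsto_id
      exact (le_fibLength k).trans (Nat.le_mul_of_pos_left _ (by omega)))
  refine ⟨ξ, degreeGtTwo_of_forall_int fun c hc => ?_, fun k => ⟨symmPoint (M k), ?_, hnorm k, ?_⟩⟩
  -- For `m ≥ k` the integer `c ⬝ᵥ symmPoint (M m)` is divisible by `p ^ ((2 * e + 4) * fibLength
  -- m)` yet smaller: `k ≤ fibLength m` and `e + 6 ≤ 2 * e + 4`, which is where `2 ≤ e` enters.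
  · obtain ⟨k, hk⟩ := pow_unbounded_of_one_lt (3 * ‖c‖) hp1
    have hzero : ∀ m, k ≤ m → c ⬝ᵥ symmPoint (M m) = 0 := by
      intro m hm
      refine int_eq_zero_of_norm_padic_le (p := p) (N := (2 * e + 4) * fibLength m) ?_ ?_
      · rw [← hdetp]
        refine (norm_dotProduct_le_L (n := 2) ?_ _).trans (hξ m)
        rw [Fin.sum_univ_three]
        simpa using hc
      · have hsum : ‖c ⬝ᵥ symmPoint (M m)‖ ≤ 3 * ‖c‖ * ‖symmPoint (M m)‖ := by
          refine (norm_sum_le _ _).trans ?_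
          have : ∀ i, ‖c i * symmPoint (M m) i‖ ≤ ‖c‖ * ‖symmPoint (M m)‖ := fun i => by
            rw [norm_mul]
            exact mul_le_mul (norm_le_pi_norm _ _) (norm_le_pi_norm _ _) (norm_nonneg _)
              (norm_nonneg _)
          rw [Fin.sum_univ_three]
          linarith [this 0, this 1, this 2]
        calc ‖c ⬝ᵥ symmPoint (M m)‖ ≤ 3 * ‖c‖ * ‖symmPoint (M m)‖ := hsum
          _ ≤ 3 * ‖c‖ * (p : ℝ) ^ ((e + 5) * fibLength m) := by
            gcongr
            exact hnorm m
          _ < (p : ℝ) ^ k * (p : ℝ) ^ ((e + 5) * fibLength m) := by gcongr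
          _ = (p : ℝ) ^ (k + (e + 5) * fibLength m) := (pow_add _ _ _).symm
          _ ≤ (p : ℝ) ^ ((2 * e + 4) * fibLength m) := by
            refine pow_le_pow_right₀ hp1.le ?_
            have := hm.trans (le_fibLength m)
            nlinarith
    -- The even index `2 * k` makes the middle factor `B * A`.
    obtain ⟨S, hS, hMS⟩ : ∃ S : Matrix (Fin 2) (Fin 2) ℤ, S 0 1 ≠ S 1 0 ∧
        M (2 * k + 2) = M (2 * k + 1) * S * M (2 * k) :=
      ⟨B * A, baseMatrixConj_mul_apply_ne hp2 e, by simp [M, fibMatrix]⟩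
    exact eq_zero_of_dotProduct_symmPoint (hsymm (2 * k)) (hsymm (2 * k + 1))
      (hMS ▸ hsymm (2 * k + 2)) (hdet0 _) (hdet0 _) hS (hzero _ (by omega)) (hzero _ (by omega))
      (hMS ▸ hzero (2 * k + 2) (by omega))
  · intro h
    have h00 : M k 0 0 = 0 := congrFun h 0
    have := hunit k
    simp [h00] at this
  · exact (hξ k).trans (hdetp k).le

theorem exists_isExponentOfApproximation (p : ℕ) [Fact p.Prime] {lam : ℝ}
    (hlam : lam < Real.goldenRatio) :
    ∃ ξ : ℚ_[p], DegreeGtTwo ξ ∧ IsExponentOfApproximation 2 ξ lam := by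
  -- This makes `t = lam - 1` nonnegative, so that `X ^ (-t)` is nonincreasing.
  wlog h1 : 1 ≤ lam generalizing lam
  · obtain ⟨ξ, h, h'⟩ := this Real.one_lt_goldenRatio le_rfl
    exact ⟨ξ, h, h'.mono (not_le.mp h1).le⟩
  have hp1 : (1 : ℝ) < p := by exact_mod_cast (Fact.out : p.Prime).one_lt
  have hp0 : (0 : ℝ) < p := by linarith
  have hg := Real.goldenRatio_pos
  obtain ⟨t, rfl⟩ : ∃ t, lam = 1 + t := ⟨lam - 1, by ring⟩
  have ht : 0 ≤ t := by linarith
  have htg : 0 < 1 - t * Real.goldenRatio := by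
    nlinarith [Real.goldenRatio_sq]
  -- The quotient solves `t * (e + 5) * γ ≤ e - 1` for `e`, possible as `t * γ < 1`; the `+ 2`
  -- secures `2 ≤ e`.
  obtain ⟨e, he⟩ := exists_nat_ge ((1 + 5 * (t * Real.goldenRatio)) / (1 - t * Real.goldenRatio) + 2)
  have he2 : 2 ≤ e := by
    have : 0 ≤ (1 + 5 * (t * Real.goldenRatio)) / (1 - t * Real.goldenRatio) := by positivity
    exact_mod_cast (by linarith : (2 : ℝ) ≤ e)
  have het : t * (e + 5) * Real.goldenRatio ≤ e - 1 := by
    have := (div_le_iff₀ htg).mp (by linarith :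
      (1 + 5 * (t * Real.goldenRatio)) / (1 - t * Real.goldenRatio) ≤ e)
    linarith
  obtain ⟨ξ, hξ, happ⟩ := exists_degreeGtTwo_forall_exists_L_le p he2
  refine ⟨ξ, hξ, (isExponentOfApproximation_iff 2 ξ _).mpr
    ⟨(p : ℝ) ^ (3 * t * (e + 5)), by positivity, fun X hX => ?_⟩⟩
  have hX0 : 0 < X := by linarith
  -- The norm bounds cut `[1, ∞)` into windows, the first starting at 1 since `fibLength 0 = 0`; the
  -- `k`-th point serves the whole `k`-th window.
  obtain ⟨k, hk1, hk2⟩ : ∃ k, (p : ℝ) ^ ((e + 5) * fibLength k) ≤ X ∧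
      X ≤ (p : ℝ) ^ ((e + 5) * fibLength (k + 1)) := by
    have hex : ∃ k, X < (p : ℝ) ^ ((e + 5) * fibLength k) := by
      obtain ⟨k, hk⟩ := pow_unbounded_of_one_lt X hp1
      refine ⟨k, hk.trans_le (pow_le_pow_right₀ hp1.le ?_)⟩
      exact (le_fibLength k).trans (Nat.le_mul_of_pos_left _ (by omega))
    classical
    have hspec := Nat.find_spec hex
    have hmin := fun m => Nat.find_min hex (m := m)
    cases hj : Nat.find hex with
    | zero =>
      rw [hj] at hspec
      simp [fibLength] at hspec
      linarith
    | succ k =>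
      rw [hj] at hspec hmin
      exact ⟨k, not_lt.mp (hmin k (Nat.lt_succ_self k)), hspec.le⟩
  obtain ⟨x, hx0, hxX, hx⟩ := happ k
  refine ⟨x, hx0, hxX.trans hk1, ?_⟩
  have hl := fibLength_succ_le k
  calc ‖x‖ * L ξ x
      ≤ (p : ℝ) ^ ((e + 5) * fibLength k) * ((p : ℝ) ^ ((2 * e + 4) * fibLength k))⁻¹ :=
        mul_le_mul hxX hx (L_nonneg _ _) (by positivity)
    _ = (p : ℝ) ^ (-((e - 1) * fibLength k : ℝ)) := by
        rw [← Real.rpow_natCast, ← Real.rpow_natCast, ← Real.rpow_neg hp0.le,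
          ← Real.rpow_add hp0]
        congr 1
        push_cast
        ring
    _ ≤ (p : ℝ) ^ (3 * t * (e + 5) + ((e + 5) * fibLength (k + 1) : ℕ) * (-t)) := by
        refine Real.rpow_le_rpow_of_exponent_le hp1.le ?_
        push_cast
        have h2 : t * (e + 5) * fibLength (k + 1) ≤
            t * (e + 5) * (Real.goldenRatio * fibLength k + 3) := by gcongr
        have h3 : t * (e + 5) * Real.goldenRatio * fibLength k ≤ (e - 1) * fibLength k := by
          gcongr
        linarith
    _ = (p : ℝ) ^ (3 * t * (e + 5)) * ((p : ℝ) ^ ((e + 5) * fibLength (k + 1))) ^ (-t) := by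
        rw [Real.rpow_add hp0, Real.rpow_mul hp0.le ((_ : ℕ) : ℝ), Real.rpow_natCast]
    _ ≤ (p : ℝ) ^ (3 * t * (e + 5)) * X ^ (1 - (1 + t)) := by
        rw [sub_add_cancel_left]
        gcongr ?_ * ?_
        exact Real.rpow_le_rpow_of_nonpos hX0 hk2 (by linarith)

end Construction

end PadicApprox

theorem mainTheorem6 (p : ℕ) [Fact p.Prime] :
    (∀ ε : ℝ, 0 < ε → ∃ ξ : ℚ_[p], PadicApprox.DegreeGtTwo ξ ∧
      ∃ c₁ : ℝ, 0 < c₁ ∧ ∀ X : ℝ, 1 ≤ X → ∃ x : Fin 3 → ℤ, x ≠ 0 ∧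
        ‖x‖ ≤ X ∧ ‖x‖ * PadicApprox.L ξ x ≤ c₁ * X ^ (-(1 / Real.goldenRatio) + ε)) ∧
    (∀ lam : ℝ, lam < Real.goldenRatio → ∃ ξ : ℚ_[p], PadicApprox.DegreeGtTwo ξ ∧
      PadicApprox.IsExponentOfApproximation 2 ξ lam) ∧
    (∀ (ξ : ℚ_[p]) (ε : ℝ),
      (∃ c₁ : ℝ, 0 < c₁ ∧ ∀ X : ℝ, 1 ≤ X → ∃ x : Fin 3 → ℤ, x ≠ 0 ∧
        ‖x‖ ≤ X ∧ ‖x‖ * PadicApprox.L ξ x ≤ c₁ * X ^ (-(1 / Real.goldenRatio) + ε)) ↔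
      PadicApprox.IsExponentOfApproximation 2 ξ (Real.goldenRatio - ε)) := by
  have hiff : ∀ (ξ : ℚ_[p]) (ε : ℝ),
      (∃ c₁ : ℝ, 0 < c₁ ∧ ∀ X : ℝ, 1 ≤ X → ∃ x : Fin 3 → ℤ, x ≠ 0 ∧
        ‖x‖ ≤ X ∧ ‖x‖ * PadicApprox.L ξ x ≤ c₁ * X ^ (-(1 / Real.goldenRatio) + ε)) ↔
      PadicApprox.IsExponentOfApproximation 2 ξ (Real.goldenRatio - ε) := by
    intro ξ ε
    have e : -(1 / Real.goldenRatio) + ε = 1 - (Real.goldenRatio - ε) := by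
      rw [one_div, Real.inv_goldenRatio, ← Real.one_sub_goldenRatio]
      ring
    rw [PadicApprox.isExponentOfApproximation_iff, e]
  refine ⟨fun ε hε => ?_, fun lam hlam => PadicApprox.exists_isExponentOfApproximation p hlam, hiff⟩
  obtain ⟨ξ, hξ, h⟩ := PadicApprox.exists_isExponentOfApproximation p
    (sub_lt_self Real.goldenRatio hε)
  exact ⟨ξ, hξ, (hiff ξ ε).mpr h⟩
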